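/- Proposition. Let $\mathsf T$ be a compactly generated triangulated category: a triangulated category (with small Hom-sets) which has set-indexed coproducts and a set $\mathcal S$ of compact objects such that an object $Y$ with $\operatorname{Hom}_{\mathsf T}(\Sigma^n S,Y)=0$ for all $S\in\mathcal S$ and $n\in\mathbb Z$ is zero. Here an object $X$ is compact if $\operatorname{Hom}_{\mathsf T}(X,-)$ respects set-indexed coproducts. Let $\mathcal K$ be a set of compact objects of $\mathsf T$ which is closed, up to isomorphism, under suspension and desuspension. Put $$\mathcal K^{\perp}=\{\,M\in\mathsf T \mid \operatorname{Hom}_{\mathsf T}(K,M)=0 \text{ for each } K\in\mathcal K\,\},$$ and let $\langle\mathcal K\rangle$ be the smallest (full, isomorphism-closed) triangulated subcategory of $\mathsf T$ which contains $\mathcal K$ and is closed under set-indexed coproducts. Let $i_*\colon\mathcal K^{\perp}\to\mathsf T$ and $j_!\colon\langle\mathcal K\rangle\to\mathsf T$ be the inclusions of these full triangulated subcategories. Then there are triangulated functors $i^*,i^!\colon\mathsf T\to\mathcal K^{\perp}$, $j^*\colon\mathsf T\to\langle\mathcal K\rangle$ and $j_*\colon\langle\mathcal K\rangle\to\mathsf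 T$ which together with $i_*$ and $j_!$ form a recollement $$\mathcal K^{\perp}\longrightarrow\mathsf T\longrightarrow\langle\mathcal K\rangle .$$ That is, there are adjoint pairs $(i^*,i_*)$, $(i_*,i^!)$, $(j_!,j^*)$, $(j^*,j_*)$, compatible with the suspensions, such that $j^*i_*=0$, the functors $i_*$, $j_!$ and $j_*$ are fully faithful, and for each $X\in\mathsf T$ the counits and units of the adjunctions fit into distinguished triangles $$j_!j^*X\to X\to i_*i^*X\to\Sigma j_!j^*X,\qquad i_*i^!X\to X\to j_*j^*X\to\Sigma i_*i^!X .$$ -/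

import Mathlib

open CategoryTheory CategoryTheory.Limits CategoryTheory.Pretriangulated Opposite ZeroObject

universe v u

namespace WrongWay

section CompactObjects

variable {T : Type u} [Category.{v} T] [Preadditive T]

/-- An object `X` is compact if the functor `Hom(X, -)`, with values in abelian groups, preserves
set-indexed coproducts, i.e. the canonical maps `⨁ i, Hom(X, Y i) → Hom(X, ∐ Y)` are bijective. -/
def IsCompactObject : ObjectProperty T := fun X ↦
  ∀ ι : Type v, PreservesColimitsOfShape (Discrete ι) (preadditiveCoyoneda.obj (op X))

end CompactObjects

section Triangulated

variable (T : Type u) [Category.{v} T] [Preadditive T] [HasZeroObject T] [HasShift T ℤ]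
  [∀ n : ℤ, (shiftFunctor T n).Additive] [Pretriangulated T]

/-- A triangulated category is compactly generated if it has set-indexed coproducts and there is a
set `S` of compact objects such that any object `Y` with `Hom(X⟦n⟧, Y) = 0` for all `X` in `S`
and all integers `n` is zero. -/
class IsCompactlyGenerated : Prop where
  hasCoproducts : HasCoproducts.{v} T
  exists_generators : ∃ S : ObjectProperty T, ObjectProperty.Small.{v} S ∧
    (∀ X, S X → IsCompactObject X) ∧
    ∀ Y : T, (∀ X, S X → ∀ (n : ℤ) (f : X⟦n⟧ ⟶ Y), f = 0) → IsZero Y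

variable {T}

/-- `P` is (the class of objects of) a full, isomorphism-closed triangulated subcategory which is
closed under set-indexed coproducts. -/
structure IsLocalizing (P : ObjectProperty T) : Prop where
  isTriangulated : P.IsTriangulated
  isClosedUnderIsomorphisms : P.IsClosedUnderIsomorphisms
  isClosedUnderCoproducts : ∀ ι : Type v, P.IsClosedUnderColimitsOfShape (Discrete ι)

/-- The localizing subcategory `⟨K⟩` generated by `K`: the intersection of all localizing
subcategories containing `K`. -/
def localizingClosure (K : ObjectProperty T) : ObjectProperty T := fun X ↦
  ∀ P : ObjectProperty T, IsLocalizing P → K ≤ P → P X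

instance (K : ObjectProperty T) : (localizingClosure K).IsTriangulated where
  exists_zero := ⟨0, isZero_zero T, fun P hP _ ↦ by
    have := hP.isTriangulated
    have := hP.isClosedUnderIsomorphisms
    exact P.prop_zero⟩
  isStableUnderShiftBy n := ⟨fun X hX P hP hK ↦ by
    have := hP.isTriangulated
    exact P.le_shift n _ (hX P hP hK)⟩
  ext₂' A hA h₁ h₃ := ObjectProperty.le_isoClosure _ _ (fun P hP hK ↦ by
    have := hP.isTriangulated
    have := hP.isClosedUnderIsomorphisms
    exact P.ext_of_isTriangulatedClosed₂ A hA (h₁ P hP hK) (h₃ P hP hK))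

/-- If `K` is closed under (de)suspension up to isomorphism, then `K^⊥` is a triangulated
subcategory. -/
instance (K : ObjectProperty T) [K.isoClosure.IsStableUnderShift ℤ] :
    K.rightOrthogonal.IsTriangulated := by
  have h : K.rightOrthogonal = K.isoClosure.rightOrthogonal := by
    ext Y
    refine ⟨fun hY X f ⟨X', hX', ⟨e⟩⟩ ↦ ?_, fun hY X f hX ↦ hY f (K.le_isoClosure X hX)⟩
    rw [← cancel_epi e.inv, comp_zero]
    exact hY _ hX'
  rw [h]
  infer_instance

end Triangulated

section Recollement

variable {A B C : Type*} [Category* A] [Category* B] [Category* C]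
  [Preadditive A] [Preadditive B] [Preadditive C]
  [HasZeroObject A] [HasZeroObject B] [HasZeroObject C]
  [HasShift A ℤ] [HasShift B ℤ] [HasShift C ℤ]
  [∀ n : ℤ, (shiftFunctor A n).Additive] [∀ n : ℤ, (shiftFunctor B n).Additive]
  [∀ n : ℤ, (shiftFunctor C n).Additive]
  [Pretriangulated A] [Pretriangulated B] [Pretriangulated C]

/-- Recollement of triangulated categories, in the sense of Beilinson, Bernstein and Deligne:
six functors between triangulated categories
`i_* : A ⥤ B`, `i^*, i^! : B ⥤ A`, `j^* : B ⥤ C`, `j_!, j_* : C ⥤ B`,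
with adjunctions `i^* ⊣ i_* ⊣ i^!` and `j_! ⊣ j^* ⊣ j_*`, form a recollement when
the functors (and adjunctions) are triangulated, `j^* i_* = 0`, the functors `i_*`, `j_!`, `j_*`
are fully faithful, and the (co)units of the adjunctions fit in distinguished triangles
`j_! j^* X → X → i_* i^* X → (j_! j^* X)⟦1⟧` and `i_* i^! X → X → j_* j^* X → (i_* i^! X)⟦1⟧`. -/
structure IsRecollement {iLower : A ⥤ B} {iUpper iShriek : B ⥤ A}
    {jUpper : B ⥤ C} {jShriek jLower : C ⥤ B}
    [iLower.CommShift ℤ] [iUpper.CommShift ℤ] [iShriek.CommShift ℤ]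
    [jUpper.CommShift ℤ] [jShriek.CommShift ℤ] [jLower.CommShift ℤ]
    (adj₁ : iUpper ⊣ iLower) (adj₂ : iLower ⊣ iShriek)
    (adj₃ : jShriek ⊣ jUpper) (adj₄ : jUpper ⊣ jLower) : Prop where
  isTriangulated₁ : adj₁.IsTriangulated
  isTriangulated₂ : adj₂.IsTriangulated
  isTriangulated₃ : adj₃.IsTriangulated
  isTriangulated₄ : adj₄.IsTriangulated
  isZero_comp (X : A) : IsZero (jUpper.obj (iLower.obj X))
  full_iLower : iLower.Full
  faithful_iLower : iLower.Faithful
  full_jShriek : jShriek.Full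
  faithful_jShriek : jShriek.Faithful
  full_jLower : jLower.Full
  faithful_jLower : jLower.Faithful
  exists_triangle (X : B) :
    ∃ d : iLower.obj (iUpper.obj X) ⟶ (jShriek.obj (jUpper.obj X))⟦(1 : ℤ)⟧,
      Triangle.mk (adj₃.counit.app X) (adj₁.unit.app X) d ∈ distTriang B
  exists_triangle' (X : B) :
    ∃ d : jLower.obj (jUpper.obj X) ⟶ (iLower.obj (iShriek.obj X))⟦(1 : ℤ)⟧,
      Triangle.mk (adj₂.counit.app X) (adj₄.unit.app X) d ∈ distTriang B

end Recollement

end WrongWay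

/-! The engine is a telescope construction. For a triangulated functor `F` preserving coproducts and
an object `C`, `exists_approximation` builds `X` in ⟨K⟩ and `F X ⟶ C` inducing bijections `Hom(k, X)
≅ Hom(F k, C)` for all `k` in `K`. For `F` the identity, the cone of `L ⟶ X` lies in `K^⊥`. As ⟨K⟩
is left orthogonal to `K^⊥`, this localization triangle computes both `j^*` and `i^*` and is the
first recollement triangle. For a set of compact generators in place of `K`, the bijections spread
to all of `T` by dévissage, which is Brown representability
(`isLeftAdjoint_of_preservesCoproducts`). Compactness of `K` makes `j^*` preserve coproducts
(`preservesCoproducts_of_adjunction`), so `j_*` exists; it is fully faithful because `j_!` is.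
Finally `j^*` kills the fibre of `X ⟶ j_* j^* X`, so this fibre lies in `K^⊥` and is `i^! X`. -/

namespace WrongWay

/-! ### Compactness, expressed by finite sums of maps through summands -/

section Finitary

variable {T : Type u} [Category.{v} T] [Preadditive T]

/-- An object `k` is finitary if every morphism from `k` to a set-indexed coproduct is a finite sum
of morphisms factoring through the summands. -/
def IsFinitary (k : T) : Prop :=
  ∀ ⦃ι : Type v⦄ ⦃Y : ι → T⦄ (c : Cofan Y) (_ : IsColimit c) (f : k ⟶ c.pt),
    f ∈ AddSubgroup.closure {g | ∃ (i : ι) (h : k ⟶ Y i), h ≫ c.inj i = g}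

/-- The quotient map by the subgroup `S` vanishes on every summand of the colimit `Hom(k, ∐ Y)`,
hence is zero. -/
lemma IsCompactObject.isFinitary {k : T} (hk : IsCompactObject k) : IsFinitary k := by
  intro ι Y c hc f
  have := hk ι
  have hc' := isColimitOfPreserves (preadditiveCoyoneda.obj (op k)) hc
  set S := AddSubgroup.closure {g | ∃ (i : ι) (h : k ⟶ Y i), h ≫ c.inj i = g}
  have h : AddCommGrpCat.ofHom (QuotientAddGroup.mk' S) =
      (0 : AddCommGrpCat.of (k ⟶ c.pt) ⟶ AddCommGrpCat.of ((k ⟶ c.pt) ⧸ S)) := by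
    refine hc'.hom_ext fun ⟨i⟩ ↦ ?_
    ext (g : k ⟶ Y i)
    exact (QuotientAddGroup.eq_zero_iff _).2 (AddSubgroup.subset_closure ⟨i, g, rfl⟩)
  exact (QuotientAddGroup.eq_zero_iff f).1
    (congrArg (fun φ : AddCommGrpCat.of (k ⟶ c.pt) ⟶ AddCommGrpCat.of ((k ⟶ c.pt) ⧸ S) ↦
      φ.hom f) h)

/-- The projections of a coproduct onto its summands. -/
lemma exists_projections {ι : Type*} {Y : ι → T} (c : Cofan Y) (hc : IsColimit c) :
    ∃ p : ∀ i, c.pt ⟶ Y i, (∀ i, c.inj i ≫ p i = 𝟙 _) ∧ ∀ i j, i ≠ j → c.inj i ≫ p j = 0 := by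
  classical
  refine ⟨fun i ↦ Cofan.IsColimit.desc hc fun j ↦ if h : j = i then eqToHom (by rw [h]) else 0,
    fun i ↦ by simp [Cofan.IsColimit.fac], fun i j h ↦ by simp [Cofan.IsColimit.fac, h]⟩

/-- A map from a finitary object is a finite sum of its components. The claim is stated for all `t ⊇
s` so that two such sums can be added over a common finite set. -/
lemma IsFinitary.eq_zero_of_comp_projections {k : T} (hk : IsFinitary k) {ι : Type v} {Y : ι → T}
    (c : Cofan Y) (hc : IsColimit c) {p : ∀ i, c.pt ⟶ Y i} (hp : ∀ i, c.inj i ≫ p i = 𝟙 _)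
    (hp' : ∀ i j, i ≠ j → c.inj i ≫ p j = 0) {f : k ⟶ c.pt} (hf : ∀ i, f ≫ p i = 0) : f = 0 := by
  classical
  suffices ∃ s : Finset ι, ∀ t, s ⊆ t → f = ∑ i ∈ t, (f ≫ p i) ≫ c.inj i by
    obtain ⟨s, hs⟩ := this
    rw [hs s subset_rfl]
    exact Finset.sum_eq_zero fun i _ ↦ by rw [hf, zero_comp]
  clear hf
  induction hk c hc f using AddSubgroup.closure_induction with
  | mem g hg =>
    obtain ⟨i, h, rfl⟩ := hg
    refine ⟨{i}, fun t ht ↦ ?_⟩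
    rw [Finset.sum_eq_single i]
    · simp [hp]
    · intro j _ hj
      simp [hp' i j hj.symm]
    · intro hi
      exact absurd (ht (Finset.mem_singleton_self i)) hi
  | zero => exact ⟨∅, fun t _ ↦ by simp⟩
  | add f g _ _ hf hg =>
    obtain ⟨s, hs⟩ := hf
    obtain ⟨s', hs'⟩ := hg
    refine ⟨s ∪ s', fun t ht ↦ ?_⟩
    simp only [Preadditive.add_comp, Finset.sum_add_distrib]
    rw [← hs t (Finset.union_subset_left ht), ← hs' t (Finset.union_subset_right ht)]
  | neg f _ hf =>
    obtain ⟨s, hs⟩ := hf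
    refine ⟨s, fun t ht ↦ ?_⟩
    simp only [Preadditive.neg_comp, Finset.sum_neg_distrib]
    rw [← hs t ht]

/-- A morphism from a finitary object to the coproduct of a sequence vanishes if it is fixed by the
transition endomorphism. -/
lemma IsFinitary.eq_zero_of_comp_transition_eq {k : T} (hk : IsFinitary k) {X : ℕ → T}
    (t : ∀ n, X n ⟶ X (n + 1)) (c : Cofan fun n : ULift.{v} ℕ ↦ X n.down) (hc : IsColimit c)
    {σ : c.pt ⟶ c.pt} (hσ : ∀ n, c.inj ⟨n⟩ ≫ σ = t n ≫ c.inj ⟨n + 1⟩)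
    {f : k ⟶ c.pt} (hf : f ≫ σ = f) : f = 0 := by
  obtain ⟨p, hp, hp'⟩ := exists_projections c hc
  refine hk.eq_zero_of_comp_projections c hc hp hp' fun ⟨n⟩ ↦ ?_
  -- The endomorphism `σ` raises the degree by one: the component of `f = f ≫ σ` in degree 0
  -- vanishes, and the one in degree `n + 1` factors through the one in degree `n`.
  induction n with
  | zero =>
    have : σ ≫ p ⟨0⟩ = 0 := Cofan.IsColimit.hom_ext hc _ _ fun ⟨n⟩ ↦ by
      rw [reassoc_of% hσ, hp' _ _ (by simp), comp_zero, comp_zero]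
    rw [← hf, Category.assoc, this, comp_zero]
  | succ n hn =>
    have : σ ≫ p ⟨n + 1⟩ = p ⟨n⟩ ≫ t n := Cofan.IsColimit.hom_ext hc _ _ fun ⟨m⟩ ↦ by
      rw [reassoc_of% hσ]
      obtain rfl | h := eq_or_ne m n
      · rw [hp, Category.comp_id, reassoc_of% (hp ⟨m⟩)]
      · rw [hp' _ _ (by simpa using h), reassoc_of% (hp' ⟨m⟩ ⟨n⟩ (by simpa using h)), comp_zero,
          zero_comp]
    rw [← hf, Category.assoc, this, reassoc_of% hn, zero_comp]

lemma IsFinitary.of_iso {k k' : T} (hk : IsFinitary k) (e : k ≅ k') : IsFinitary k' := by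
  intro ι Y c hc f
  suffices ∀ g : k ⟶ c.pt,
      e.inv ≫ g ∈ AddSubgroup.closure {g | ∃ (i : ι) (h : k' ⟶ Y i), h ≫ c.inj i = g} by
    simpa using this (e.hom ≫ f)
  intro g
  induction hk c hc g using AddSubgroup.closure_induction with
  | mem g hg =>
    obtain ⟨i, h, rfl⟩ := hg
    exact AddSubgroup.subset_closure ⟨i, e.inv ≫ h, by simp⟩
  | zero => simp
  | add f g _ _ hf hg => simpa using add_mem hf hg
  | neg f _ hf => simpa using hf

/-- The image of a coproduct cofan under a functor preserving this coproduct. -/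
noncomputable def isColimitCofanMap {C D : Type*} [Category* C] [Category* D] (G : C ⥤ D)
    {ι : Type*} [PreservesColimitsOfShape (Discrete ι) G] {Y : ι → C} (c : Cofan Y)
    (hc : IsColimit c) : IsColimit (Cofan.mk (G.obj c.pt) fun i ↦ G.map (c.inj i)) :=
  Cofan.isColimitMapCoconeEquiv G Y c (isColimitOfPreserves G hc)

/-- Finite decompositions transfer along the adjunction because `G` preserves the coproduct. -/
lemma IsFinitary.leftAdjoint_obj {D : Type*} [Category.{v} D] [Preadditive D] {F : D ⥤ T}
    {G : T ⥤ D} (adj : F ⊣ G) [F.Additive]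
    (hG : ∀ ι : Type v, PreservesColimitsOfShape (Discrete ι) G) {k : D}
    (hk : IsFinitary k) : IsFinitary (F.obj k) := by
  intro ι Y c hc f
  have := hG ι
  suffices ∀ g : k ⟶ G.obj c.pt, F.map g ≫ adj.counit.app _ ∈
      AddSubgroup.closure {g | ∃ (i : ι) (h : F.obj k ⟶ Y i), h ≫ c.inj i = g} by
    simpa using this (adj.unit.app _ ≫ G.map f)
  intro g
  induction hk _ (isColimitCofanMap G c hc) g using AddSubgroup.closure_induction with
  | mem g hg =>
    obtain ⟨i, h, rfl⟩ := hg
    exact AddSubgroup.subset_closure ⟨i, F.map h ≫ adj.counit.app _, by simp⟩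
  | zero => simp
  | add f g _ _ hf hg => simpa using add_mem hf hg
  | neg f _ hf => simpa using hf

lemma IsFinitary.shift [HasShift T ℤ] [∀ n : ℤ, (shiftFunctor T n).Additive] {k : T}
    (hk : IsFinitary k) (n : ℤ) : IsFinitary (k⟦n⟧) :=
  hk.leftAdjoint_obj (F := shiftFunctor T n) (shiftEquiv T n).toAdjunction fun _ ↦ inferInstance

end Finitary

/-! ### Maps out of the image of a coproduct -/

section Coproducts

variable {T : Type u} [Category.{v} T]

/-- A small family of representatives indexing the objects satisfying `K`. -/
lemma exists_family (K : ObjectProperty T) [ObjectProperty.Small.{v} K] :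
    ∃ (J : Type v) (k : J → T), (∀ j, K (k j)) ∧ ∀ X, K X → ∃ j, k j = X :=
  ⟨Shrink.{v} (Subtype K), fun j ↦ ((equivShrink _).symm j).1, fun j ↦ ((equivShrink _).symm j).2,
    fun X hX ↦ ⟨equivShrink _ ⟨X, hX⟩, by simp⟩⟩

variable [HasCoproducts.{v} T] {D : Type*} [Category* D] {F : T ⥤ D}

lemma exists_map_ι_comp_eq {ι : Type v}
    [PreservesColimitsOfShape (Discrete ι) F] {Y : ι → T} {C : D}
    (φ : ∀ i, F.obj (Y i) ⟶ C) : ∃ ψ : F.obj (∐ Y) ⟶ C, ∀ i, F.map (Sigma.ι Y i) ≫ ψ = φ i :=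
  ⟨Cofan.IsColimit.desc (isColimitCofanMap F _ (coproductIsCoproduct Y)) φ,
    Cofan.IsColimit.fac (isColimitCofanMap F _ (coproductIsCoproduct Y)) φ⟩

lemma map_ι_hom_ext {ι : Type v}
    [PreservesColimitsOfShape (Discrete ι) F] {Y : ι → T} {C : D}
    {φ ψ : F.obj (∐ Y) ⟶ C} (h : ∀ i, F.map (Sigma.ι Y i) ≫ φ = F.map (Sigma.ι Y i) ≫ ψ) : φ = ψ :=
  Cofan.IsColimit.hom_ext (isColimitCofanMap F _ (coproductIsCoproduct Y)) _ _ h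

end Coproducts

/-! ### Localizing subcategories and the telescope construction -/

section Localizing

variable {T : Type u} [Category.{v} T] [Preadditive T] [HasZeroObject T] [HasShift T ℤ]
  [∀ n : ℤ, (shiftFunctor T n).Additive] [Pretriangulated T]

lemma isLocalizing_localizingClosure (K : ObjectProperty T) :
    IsLocalizing (localizingClosure K) where
  isTriangulated := inferInstance
  isClosedUnderIsomorphisms := ⟨fun e hX P hP hK ↦ by
    have := hP.isClosedUnderIsomorphisms
    exact P.prop_of_iso e (hX P hP hK)⟩
  isClosedUnderCoproducts ι := ⟨fun X ⟨h⟩ P hP hK ↦ by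
    have := hP.isClosedUnderCoproducts ι
    exact ObjectProperty.ColimitOfShape.prop (h.ofLE fun Y hY ↦ hY P hP hK)⟩

lemma le_localizingClosure (K : ObjectProperty T) : K ≤ localizingClosure K :=
  fun _ hX _ _ hK ↦ hK _ hX

instance (K : ObjectProperty T) : (localizingClosure K).IsClosedUnderIsomorphisms :=
  (isLocalizing_localizingClosure K).isClosedUnderIsomorphisms

instance (K : ObjectProperty T) (ι : Type v) :
    (localizingClosure K).IsClosedUnderColimitsOfShape (Discrete ι) :=
  (isLocalizing_localizingClosure K).isClosedUnderCoproducts ι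

variable {D : Type*} [Category.{v} D] [Preadditive D] [HasZeroObject D] [HasShift D ℤ]
  [∀ n : ℤ, (shiftFunctor D n).Additive] [Pretriangulated D]
  (F : T ⥤ D) [F.CommShift ℤ] [F.IsTriangulated]

lemma exists_map_comp_eq {X Y Z : T} {f : X ⟶ Y} {g : Y ⟶ Z} {h : Z ⟶ X⟦(1 : ℤ)⟧}
    (hT : Triangle.mk f g h ∈ distTriang T) {C : D} (φ : F.obj Y ⟶ C)
    (hφ : F.map f ≫ φ = 0) : ∃ ψ : F.obj Z ⟶ C, F.map g ≫ ψ = φ := by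
  obtain ⟨ψ, hψ⟩ := Triangle.yoneda_exact₂ _ (F.map_distinguished _ hT) φ hφ
  exact ⟨ψ, hψ.symm⟩

variable [HasCoproducts.{v} T] [∀ ι : Type v, PreservesColimitsOfShape (Discrete ι) F] (C : D)
  (K : ObjectProperty T) [ObjectProperty.Small.{v} K]

omit [Preadditive D] [HasZeroObject D] [HasShift D ℤ] [∀ n : ℤ, (shiftFunctor D n).Additive]
  [Pretriangulated D] [F.CommShift ℤ] [F.IsTriangulated] in
-- Take the coproduct of one copy of `k` for each map `F k ⟶ C`.
lemma exists_surjective_approximation : ∃ (X : T) (φ : F.obj X ⟶ C), localizingClosure K X ∧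
    ∀ (k : T), K k → ∀ g : F.obj k ⟶ C, ∃ f : k ⟶ X, F.map f ≫ φ = g := by
  obtain ⟨J, k, hk, hk'⟩ := exists_family K
  let Y : (Σ j, F.obj (k j) ⟶ C) → T := fun i ↦ k i.1
  obtain ⟨φ, hφ⟩ := exists_map_ι_comp_eq (F := F) (Y := Y) (C := C) fun i ↦ i.2
  refine ⟨∐ Y, φ, ObjectProperty.prop_colimit _ _ fun i ↦ le_localizingClosure K _ (hk _),
    fun X hX g ↦ ?_⟩
  obtain ⟨j, rfl⟩ := hk' X hX
  exact ⟨Sigma.ι Y ⟨j, g⟩, hφ ⟨j, g⟩⟩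

variable {C} in
-- Take the cone of the coproduct of all maps `k ⟶ X` that die in `C`.
lemma exists_kernel_killing {X : T} (φ : F.obj X ⟶ C) (hX : localizingClosure K X) :
    ∃ (X' : T) (φ' : F.obj X' ⟶ C) (t : X ⟶ X'), localizingClosure K X' ∧ F.map t ≫ φ' = φ ∧
      ∀ (k : T), K k → ∀ f : k ⟶ X, F.map f ≫ φ = 0 → f ≫ t = 0 := by
  obtain ⟨J, k, hk, hk'⟩ := exists_family K
  let Y : (Σ j, {f : k j ⟶ X // F.map f ≫ φ = 0}) → T := fun i ↦ k i.1
  let a : ∐ Y ⟶ X := Sigma.desc fun i ↦ i.2.1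
  obtain ⟨X', t, b, hA⟩ := distinguished_cocone_triangle a
  obtain ⟨φ', hφ'⟩ := exists_map_comp_eq F hA φ (map_ι_hom_ext fun i ↦ by
    rw [← F.map_comp_assoc, Sigma.ι_desc, i.2.2, comp_zero])
  refine ⟨X', φ', t, ObjectProperty.ext_of_isTriangulatedClosed₃ _ _ hA
    (ObjectProperty.prop_colimit _ _ fun i ↦ le_localizingClosure K _ (hk _)) hX, hφ',
    fun Z hZ f hf ↦ ?_⟩
  obtain ⟨j, rfl⟩ := hk' Z hZ
  have h : Sigma.ι Y ⟨j, f, hf⟩ ≫ a = f := Sigma.ι_desc _ _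
  have h' : a ≫ t = 0 := comp_distTriang_mor_zero₁₂ _ hA
  rw [← h, Category.assoc, h', comp_zero]

/-- Brown representability, restricted to the objects of a small set of finitary objects. -/
theorem exists_approximation (hK : ∀ k, K k → IsFinitary k) :
    ∃ (X : T) (φ : F.obj X ⟶ C), localizingClosure K X ∧
      ∀ (k : T), K k → Function.Bijective fun f : k ⟶ X ↦ F.map f ≫ φ := by
  obtain ⟨X₀, φ₀, hX₀, h₀⟩ := exists_surjective_approximation F C K
  choose X' φ' t' hX' hφ' ht' using
    fun (A : Σ' (X : T), PProd (F.obj X ⟶ C) (localizingClosure K X)) ↦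
    exists_kernel_killing F K A.2.1 A.2.2
  let A : ℕ → Σ' (X : T), PProd (F.obj X ⟶ C) (localizingClosure K X) := fun n ↦
    Nat.rec ⟨X₀, φ₀, hX₀⟩ (fun _ A ↦ ⟨X' A, φ' A, hX' A⟩) n
  let X : ℕ → T := fun n ↦ (A n).1
  let φ : ∀ n, F.obj (X n) ⟶ C := fun n ↦ (A n).2.1
  let t : ∀ n, X n ⟶ X (n + 1) := fun n ↦ t' (A n)
  have hφ : ∀ n, F.map (t n) ≫ φ (n + 1) = φ n := fun n ↦ hφ' (A n)
  have ht : ∀ n (k : T), K k → ∀ f : k ⟶ X n, F.map f ≫ φ n = 0 → f ≫ t n = 0 :=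
    fun n ↦ ht' (A n)
  let Y : ULift.{v} ℕ → T := fun n ↦ X n.down
  let s : ∐ Y ⟶ ∐ Y := Sigma.desc fun n ↦ t n.down ≫ Sigma.ι Y ⟨n.down + 1⟩
  have hs : ∀ n, Sigma.ι Y ⟨n⟩ ≫ s = t n ≫ Sigma.ι Y ⟨n + 1⟩ := fun n ↦ Sigma.ι_desc _ _
  have hY : localizingClosure K (∐ Y) := ObjectProperty.prop_colimit _ _ fun n ↦ (A n.as.down).2.2
  -- `Z` is the homotopy colimit of the tower `X 0 ⟶ X 1 ⟶ ⋯`.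
  obtain ⟨Z, π, δ, hZ⟩ := distinguished_cocone_triangle (𝟙 _ - s)
  have hsπ : s ≫ π = π := by
    have : (𝟙 _ - s) ≫ π = 0 := comp_distTriang_mor_zero₁₂ _ hZ
    rw [Preadditive.sub_comp, Category.id_comp, sub_eq_zero] at this
    exact this.symm
  have hι : ∀ n, t n ≫ Sigma.ι Y ⟨n + 1⟩ ≫ π = Sigma.ι Y ⟨n⟩ ≫ π := fun n ↦ by
    rw [← reassoc_of% hs, hsπ]
  obtain ⟨ψ, hψ⟩ := exists_map_ι_comp_eq (F := F) (Y := Y) fun n ↦ φ n.down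
  obtain ⟨χ, hχ⟩ := exists_map_comp_eq F hZ ψ (map_ι_hom_ext fun ⟨n⟩ ↦ by
    rw [← F.map_comp_assoc, Preadditive.comp_sub, hs, Category.comp_id, F.map_sub,
      Preadditive.sub_comp, F.map_comp, Category.assoc, hψ, hψ, hφ, sub_self, comp_zero])
  refine ⟨Z, χ, ObjectProperty.ext_of_isTriangulatedClosed₃ _ _ hZ hY hY, fun k hk ↦ ⟨?_, ?_⟩⟩
  -- Up to `π`, a map into the coproduct comes from a single stage: it is a finite sum, and the
  -- transition maps move all terms to a common stage.
  · have key : ∀ f : k ⟶ ∐ Y, ∃ n, ∃ g : k ⟶ X n, f ≫ π = g ≫ Sigma.ι Y ⟨n⟩ ≫ π := by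
      have hm : ∀ (n m : ℕ), n ≤ m → ∀ g : k ⟶ X n, ∃ g' : k ⟶ X m,
          g ≫ Sigma.ι Y ⟨n⟩ ≫ π = g' ≫ Sigma.ι Y ⟨m⟩ ≫ π := fun n m hnm g ↦ by
        induction m, hnm using Nat.le_induction with
        | base => exact ⟨g, rfl⟩
        | succ m _ hm =>
          obtain ⟨g', hg'⟩ := hm
          exact ⟨g' ≫ t _, by rw [hg', ← hι m, Category.assoc]⟩
      intro f
      induction hK k hk _ (coproductIsCoproduct Y) f using AddSubgroup.closure_induction with
      | mem f hf =>
        obtain ⟨⟨n⟩, g, rfl⟩ := hf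
        exact ⟨n, g, by simp⟩
      | zero => exact ⟨0, 0, by simp⟩
      | add f f' _ _ hf hf' =>
        obtain ⟨n, g, hg⟩ := hf
        obtain ⟨n', g', hg'⟩ := hf'
        obtain ⟨h, hh⟩ := hm n (n + n') (by lia) g
        obtain ⟨h', hh'⟩ := hm n' (n + n') (by lia) g'
        exact ⟨n + n', h + h', by simp only [Preadditive.add_comp, hg, hg', hh, hh']⟩
      | neg f _ hf =>
        obtain ⟨n, g, hg⟩ := hf
        exact ⟨n, -g, by simp [hg]⟩
    refine (injective_iff_map_eq_zero (AddMonoidHom.mk' (fun f : k ⟶ Z ↦ F.map f ≫ χ)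
      fun _ _ ↦ by simp)).2 fun f hf ↦ ?_
    -- Since `δ` is killed by the shift of `𝟙 - s`, the map `f ≫ δ` is fixed by the shift of `s`,
    -- which is the transition endomorphism of the coproduct of the shifted tower.
    have hfδ : f ≫ δ = 0 := by
      have hs' : ∀ n, (Sigma.ι Y ⟨n⟩)⟦(1 : ℤ)⟧' ≫ s⟦1⟧' = (t n)⟦1⟧' ≫ (Sigma.ι Y ⟨n + 1⟩)⟦1⟧' :=
        fun n ↦ by rw [← Functor.map_comp, hs, Functor.map_comp]
      refine (hK k hk).eq_zero_of_comp_transition_eq (X := fun n ↦ (X n)⟦(1 : ℤ)⟧)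
        (fun n ↦ (t n)⟦(1 : ℤ)⟧') _
        (isColimitCofanMap (shiftFunctor T (1 : ℤ)) _ (coproductIsCoproduct Y)) hs' ?_
      have : δ ≫ (𝟙 _ - s)⟦(1 : ℤ)⟧' = 0 := comp_distTriang_mor_zero₃₁ _ hZ
      rw [Functor.map_sub, CategoryTheory.Functor.map_id, Preadditive.comp_sub, sub_eq_zero,
        Category.comp_id] at this
      exact (Category.assoc _ _ _).trans (by rw [← this])
    obtain ⟨f', hf'⟩ : ∃ f' : k ⟶ ∐ Y, f = f' ≫ π := Triangle.coyoneda_exact₃ _ hZ f hfδ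
    obtain ⟨n, g, hg⟩ := key f'
    -- The representative `g` dies in `C`, so it is killed one stage later.
    have hg0 : g ≫ t n = 0 := ht n k hk g (by
      have : F.map (g ≫ Sigma.ι Y ⟨n⟩ ≫ π) ≫ χ = 0 := by rw [← hg, ← hf']; exact hf
      rwa [F.map_comp, F.map_comp, Category.assoc, Category.assoc, hχ, hψ] at this)
    rw [hf', hg, ← hι, reassoc_of% hg0, zero_comp]
  · intro g
    obtain ⟨f, hf⟩ := h₀ k hk g
    refine ⟨f ≫ Sigma.ι Y ⟨0⟩ ≫ π, ?_⟩
    dsimp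
    rw [F.map_comp, F.map_comp, Category.assoc, Category.assoc, hχ, hψ]
    exact hf

end Localizing

/-! ### Dévissage: extending the bijections to a localizing subcategory -/

section MapComp

variable {T : Type u} [Category.{v} T] [Preadditive T] {D : Type*} [Category.{v} D] [Preadditive D]
  {F : T ⥤ D} [F.Additive] {X : T} {C : D}

/-- The natural map `Hom(Z, X) → Hom(F Z, C)` attached to a morphism `F X ⟶ C`. -/
def mapComp (φ : F.obj X ⟶ C) (Z : T) : (Z ⟶ X) →+ (F.obj Z ⟶ C) :=
  AddMonoidHom.mk' (fun f ↦ F.map f ≫ φ) fun _ _ ↦ by simp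

@[simp]
lemma mapComp_apply (φ : F.obj X ⟶ C) {Z : T} (f : Z ⟶ X) : mapComp φ Z f = F.map f ≫ φ := rfl

lemma mapComp_bijective_of_iso (φ : F.obj X ⟶ C) {Z Z' : T} (e : Z ≅ Z')
    (h : Function.Bijective (mapComp φ Z)) : Function.Bijective (mapComp φ Z') := by
  refine ⟨(injective_iff_map_eq_zero _).2 fun f hf ↦ ?_, fun g ↦ ?_⟩
  · have := (injective_iff_map_eq_zero _).1 h.1 (e.hom ≫ f) (by
      simpa using F.map e.hom ≫= hf)
    simpa using this
  · obtain ⟨f, hf⟩ := h.2 (F.map e.hom ≫ g)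
    refine ⟨e.inv ≫ f, ?_⟩
    simp only [mapComp_apply] at hf
    simp [hf, ← F.map_comp_assoc]

lemma mapComp_bijective_of_isColimit {J : Type*} [Category* J] [PreservesColimitsOfShape J F]
    (φ : F.obj X ⟶ C) {Y : J ⥤ T} (c : Cocone Y) (hc : IsColimit c)
    (h : ∀ j, Function.Bijective (mapComp φ (Y.obj j))) :
    Function.Bijective (mapComp φ c.pt) := by
  refine ⟨(injective_iff_map_eq_zero _).2 fun f hf ↦ hc.hom_ext fun j ↦ ?_, fun g ↦ ?_⟩
  · rw [comp_zero]
    exact (injective_iff_map_eq_zero _).1 (h j).1 _ (by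
      simpa using F.map (c.ι.app j) ≫= hf)
  · choose f hf using fun j ↦ (h j).2 (F.map (c.ι.app j) ≫ g)
    simp only [mapComp_apply] at hf
    let s : Cocone Y :=
      { pt := X
        ι := { app := f
               naturality i j a := (h i).1 (by
                simp only [mapComp_apply, F.map_comp, Category.assoc, hf]
                simp [← F.map_comp_assoc, hf]) } }
    refine ⟨hc.desc s, (isColimitOfPreserves F hc).hom_ext fun j ↦ ?_⟩
    change F.map (c.ι.app j) ≫ F.map (hc.desc s) ≫ φ = F.map (c.ι.app j) ≫ g
    rw [← F.map_comp_assoc, hc.fac, ← hf]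

variable [HasZeroObject T] [HasShift T ℤ]
  [∀ n : ℤ, (shiftFunctor T n).Additive] [Pretriangulated T]
  [HasZeroObject D] [HasShift D ℤ]
  [∀ n : ℤ, (shiftFunctor D n).Additive] [Pretriangulated D]
  [F.CommShift ℤ] [F.IsTriangulated]

/-- This is the five lemma for `Hom(-, X)` and `Hom(F -, C)`; the outer terms need only surjectivity
on one side and injectivity on the other. -/
lemma mapComp_bijective_of_distinguished (φ : F.obj X ⟶ C) {Z₁ Z₂ Z₃ : T} {f : Z₁ ⟶ Z₂}
    {g : Z₂ ⟶ Z₃} {h : Z₃ ⟶ Z₁⟦(1 : ℤ)⟧} (hT : Triangle.mk f g h ∈ distTriang T)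
    (h₁ : Function.Bijective (mapComp φ Z₁)) (h₃ : Function.Bijective (mapComp φ Z₃))
    (h₁' : Function.Surjective (mapComp φ (Z₁⟦(1 : ℤ)⟧)))
    (h₃' : Function.Injective (mapComp φ (Z₃⟦(-1 : ℤ)⟧))) :
    Function.Bijective (mapComp φ Z₂) := by
  have hfg : f ≫ g = 0 := comp_distTriang_mor_zero₁₂ _ hT
  have hgh : g ≫ h = 0 := comp_distTriang_mor_zero₂₃ _ hT
  refine ⟨(injective_iff_map_eq_zero _).2 fun a ha ↦ ?_, fun y ↦ ?_⟩
  · simp only [mapComp_apply] at ha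
    have hfa : f ≫ a = 0 := (injective_iff_map_eq_zero _).1 h₁.1 _ (by simp [ha])
    obtain ⟨b, hb⟩ : ∃ b : Z₃ ⟶ X, a = g ≫ b := Triangle.yoneda_exact₂ _ hT a hfa
    have hT' : Triangle.mk g h (-f⟦(1 : ℤ)⟧') ∈ distTriang T := rot_of_distTriang _ hT
    obtain ⟨y, hy⟩ := exists_map_comp_eq F hT' (F.map b ≫ φ) (by
      rw [← F.map_comp_assoc, ← hb, ha])
    obtain ⟨d, rfl⟩ := h₁' y
    have : b = h ≫ d := h₃.1 (by simpa using hy.symm)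
    rw [hb, this, reassoc_of% hgh, zero_comp]
  · obtain ⟨a, ha⟩ := h₁.2 (F.map f ≫ y)
    simp only [mapComp_apply] at ha
    obtain ⟨e, e', hT'⟩ : ∃ (e : Z₃⟦(-1 : ℤ)⟧ ⟶ Z₁) (e' : Z₂ ⟶ Z₃⟦(-1 : ℤ)⟧⟦(1 : ℤ)⟧),
      Triangle.mk e f e' ∈ distTriang T := ⟨_, _, inv_rot_of_distTriang _ hT⟩
    have hef : e ≫ f = 0 := comp_distTriang_mor_zero₁₂ _ hT'
    obtain ⟨b, hb⟩ : ∃ b : Z₂ ⟶ X, a = f ≫ b := Triangle.yoneda_exact₂ _ hT' a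
      ((injective_iff_map_eq_zero _).1 h₃' (e ≫ a) (by
        rw [mapComp_apply, F.map_comp, Category.assoc, ha, ← F.map_comp_assoc, hef, F.map_zero,
          zero_comp]))
    obtain ⟨z, hz⟩ := exists_map_comp_eq F hT (y - F.map b ≫ φ) (by
      rw [Preadditive.comp_sub, ← ha, hb, F.map_comp, Category.assoc, sub_self])
    obtain ⟨d, rfl⟩ := h₃.2 z
    exact ⟨b + g ≫ d, by simpa using (congrArg (F.map b ≫ φ + ·) hz)⟩

/-- Quantifying over all shifts makes the class shift-stable and supplies the outer terms of the
five lemma. -/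
lemma isLocalizing_mapComp_bijective [∀ ι : Type v, PreservesColimitsOfShape (Discrete ι) F]
    (φ : F.obj X ⟶ C) :
    IsLocalizing fun Z ↦ ∀ n : ℤ, Function.Bijective (mapComp φ (Z⟦n⟧)) := by
  have iso {Z Z' : T} (e : Z ≅ Z') (h : ∀ n : ℤ, Function.Bijective (mapComp φ (Z⟦n⟧))) (n : ℤ) :
      Function.Bijective (mapComp φ (Z'⟦n⟧)) :=
    mapComp_bijective_of_iso φ ((shiftFunctor T n).mapIso e) (h n)
  let P : ObjectProperty T := fun Z ↦ ∀ n : ℤ, Function.Bijective (mapComp φ (Z⟦n⟧))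
  refine ⟨{ exists_zero := ?_, isStableUnderShiftBy := ?_, ext₂' := ?_ }, ⟨iso⟩, fun ι ↦ ⟨?_⟩⟩
  · refine ⟨0, isZero_zero T, fun n ↦ ?_⟩
    have h := (shiftFunctor T n).map_isZero (isZero_zero T)
    exact ⟨fun _ _ _ ↦ h.eq_of_src _ _, fun _ ↦ ⟨0, (F.map_isZero h).eq_of_src _ _⟩⟩
  · exact fun a ↦ ⟨fun Z hZ n ↦ mapComp_bijective_of_iso φ ((shiftFunctorAdd T a n).app Z) (hZ _)⟩
  · refine fun A hA h₁ h₃ ↦ ObjectProperty.le_isoClosure _ _ fun n ↦ ?_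
    exact mapComp_bijective_of_distinguished φ (Triangle.shift_distinguished A hA n) (h₁ n) (h₃ n)
      (mapComp_bijective_of_iso φ ((shiftFunctorAdd T n 1).app _) (h₁ _)).2
      (mapComp_bijective_of_iso φ ((shiftFunctorAdd T n (-1)).app _) (h₃ _)).1
  · rintro Z ⟨h⟩ n
    exact mapComp_bijective_of_isColimit φ _ (isColimitOfPreserves (shiftFunctor T n) h.isColimit)
      fun j ↦ h.prop_diag_obj j n

end MapComp

/-! ### Adjoints from universal arrows -/

section Universal

variable {C D : Type*} [Category* C] [Category* D]

/-- A universal arrow from a functor is a terminal object of the category of arrows. -/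
noncomputable def isTerminalOfBijective (F : C ⥤ D) {X : C} {Y : D} (φ : F.obj X ⟶ Y)
    (h : ∀ Z, Function.Bijective fun f : Z ⟶ X ↦ F.map f ≫ φ) :
    IsTerminal (CostructuredArrow.mk φ) :=
  IsTerminal.ofUniqueHom
    (fun A ↦ CostructuredArrow.homMk ((h A.left).2 A.hom).choose ((h A.left).2 A.hom).choose_spec)
    fun A m ↦ CostructuredArrow.hom_ext _ _ ((h A.left).1 (by
      have := ((h A.left).2 A.hom).choose_spec
      have := CostructuredArrow.w m
      dsimp at *
      simp_all))

/-- A universal arrow to a functor is an initial object of the category of arrows. -/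
noncomputable def isInitialOfBijective (G : D ⥤ C) {X : C} {Y : D} (φ : X ⟶ G.obj Y)
    (h : ∀ Z, Function.Bijective fun f : Y ⟶ Z ↦ φ ≫ G.map f) :
    IsInitial (StructuredArrow.mk φ) :=
  IsInitial.ofUniqueHom
    (fun A ↦ StructuredArrow.homMk ((h A.right).2 A.hom).choose ((h A.right).2 A.hom).choose_spec)
    fun A m ↦ StructuredArrow.hom_ext _ _ ((h A.right).1 (by
      have := ((h A.right).2 A.hom).choose_spec
      have := StructuredArrow.w m
      dsimp at *
      simp_all))

lemma isLeftAdjoint_of_bijective (F : C ⥤ D) (h : ∀ Y : D, ∃ (X : C) (φ : F.obj X ⟶ Y),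
    ∀ Z, Function.Bijective fun f : Z ⟶ X ↦ F.map f ≫ φ) : F.IsLeftAdjoint := by
  refine isLeftAdjoint_iff_hasTerminal_costructuredArrow.2 fun Y ↦ ?_
  obtain ⟨X, φ, hφ⟩ := h Y
  exact (isTerminalOfBijective F φ hφ).hasTerminal

lemma isRightAdjoint_of_bijective (G : D ⥤ C) (h : ∀ X : C, ∃ (Y : D) (φ : X ⟶ G.obj Y),
    ∀ Z, Function.Bijective fun f : Y ⟶ Z ↦ φ ≫ G.map f) : G.IsRightAdjoint := by
  refine isRightAdjoint_iff_hasInitial_structuredArrow.2 fun X ↦ ?_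
  obtain ⟨Y, φ, hφ⟩ := h X
  exact (isInitialOfBijective G φ hφ).hasInitial

lemma exists_iso_counit {F : C ⥤ D} {G : D ⥤ C} (adj : F ⊣ G) {X : C} {Y : D} (φ : F.obj X ⟶ Y)
    (h : ∀ Z, Function.Bijective fun f : Z ⟶ X ↦ F.map f ≫ φ) :
    ∃ e : G.obj Y ≅ X, F.map e.hom ≫ φ = adj.counit.app Y := by
  let e := (mkTerminalOfRightAdjoint _ adj Y).uniqueUpToIso (isTerminalOfBijective F φ h)
  exact ⟨(CostructuredArrow.proj F Y).mapIso e, CostructuredArrow.w e.hom⟩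

lemma exists_iso_unit {F : C ⥤ D} {G : D ⥤ C} (adj : F ⊣ G) {X : C} {Y : D} (φ : X ⟶ G.obj Y)
    (h : ∀ Z, Function.Bijective fun f : Y ⟶ Z ↦ φ ≫ G.map f) :
    ∃ e : Y ≅ F.obj X, φ ≫ G.map e.hom = adj.unit.app X := by
  let e := (isInitialOfBijective G φ h).uniqueUpToIso (mkInitialOfLeftAdjoint _ adj X)
  exact ⟨(StructuredArrow.proj X G).mapIso e, StructuredArrow.w e.hom⟩

end Universal

/-! ### Orthogonality and localization triangles -/

section Orthogonal

variable {T : Type u} [Category.{v} T] [Preadditive T] [HasZeroObject T] [HasShift T ℤ]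
  [∀ n : ℤ, (shiftFunctor T n).Additive] [Pretriangulated T]

section

variable {L X Y : T} {a : L ⟶ X} {b : X ⟶ Y} {c : Y ⟶ L⟦(1 : ℤ)⟧}
  (hT : Triangle.mk a b c ∈ distTriang T)
include hT

/-- Both `Hom(Z, Y⟦-1⟧)` and `Hom(Z, Y)` vanish, so the long exact sequence shows that `a` is a
universal arrow from `P`. -/
lemma bijective_ι_map_comp (P : ObjectProperty T) [P.IsStableUnderShift ℤ] (hL : P L)
    (hY : P.rightOrthogonal Y) (Z : P.FullSubcategory) :
    Function.Bijective fun f : Z ⟶ ⟨L, hL⟩ ↦ P.ι.map f ≫ a := by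
  refine ⟨fun f g hfg ↦ ?_, fun g ↦ ?_⟩
  · obtain ⟨e, e', hT'⟩ : ∃ (e : Y⟦(-1 : ℤ)⟧ ⟶ L) (e' : X ⟶ Y⟦(-1 : ℤ)⟧⟦(1 : ℤ)⟧),
      Triangle.mk e a e' ∈ distTriang T := ⟨_, _, inv_rot_of_distTriang _ hT⟩
    let f' : Z.obj ⟶ L := f.hom
    let g' : Z.obj ⟶ L := g.hom
    have hfg' : (f' - g') ≫ a = 0 := (Preadditive.sub_comp ..).trans (sub_eq_zero.2 hfg)
    obtain ⟨h, hh⟩ : ∃ h : Z.obj ⟶ Y⟦(-1 : ℤ)⟧, f' - g' = h ≫ e :=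
      Triangle.coyoneda_exact₂ _ hT' _ hfg'
    rw [P.rightOrthogonal.le_shift (-1) _ hY h Z.property, zero_comp, sub_eq_zero] at hh
    exact ObjectProperty.hom_ext P hh
  · obtain ⟨f, hf⟩ : ∃ f : Z.obj ⟶ L, g = f ≫ a :=
      Triangle.coyoneda_exact₂ _ hT g (hY _ Z.property)
    exact ⟨ObjectProperty.homMk f, hf.symm⟩

lemma bijective_comp_ι_map (Q : ObjectProperty T) [Q.IsStableUnderShift ℤ] (hY : Q Y)
    (hL : Q.leftOrthogonal L) (Z : Q.FullSubcategory) :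
    Function.Bijective fun f : (⟨Y, hY⟩ : Q.FullSubcategory) ⟶ Z ↦ b ≫ Q.ι.map f := by
  refine ⟨fun f g hfg ↦ ?_, fun g ↦ ?_⟩
  · let f' : Y ⟶ Z.obj := f.hom
    let g' : Y ⟶ Z.obj := g.hom
    have hfg' : b ≫ (f' - g') = 0 := (Preadditive.comp_sub ..).trans (sub_eq_zero.2 hfg)
    obtain ⟨h, hh⟩ : ∃ h : L⟦(1 : ℤ)⟧ ⟶ Z.obj, f' - g' = c ≫ h :=
      Triangle.yoneda_exact₃ _ hT _ hfg'
    rw [Q.leftOrthogonal.le_shift 1 _ hL h Z.property, comp_zero, sub_eq_zero] at hh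
    exact ObjectProperty.hom_ext Q hh
  · obtain ⟨f, hf⟩ : ∃ f : Y ⟶ Z.obj, g = b ≫ f :=
      Triangle.yoneda_exact₂ _ hT g (hL _ Z.property)
    exact ⟨ObjectProperty.homMk f, hf.symm⟩

/-- A map `f : k ⟶ Y` has `f ≫ c = 0` by injectivity at a desuspension of `k`, so it lifts to `X`;
by surjectivity at `k` the lift factors through `a`, and `a ≫ b = 0`. -/
lemma rightOrthogonal_of_bijective (K : ObjectProperty T) [K.isoClosure.IsStableUnderShift ℤ]
    (ha : ∀ k, K k → Function.Bijective fun f : k ⟶ L ↦ f ≫ a) : K.rightOrthogonal Y := by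
  intro k f hk
  have hac : c ≫ a⟦(1 : ℤ)⟧' = 0 := comp_distTriang_mor_zero₃₁ _ hT
  have hab : a ≫ b = 0 := comp_distTriang_mor_zero₁₂ _ hT
  obtain ⟨k', hk', ⟨e⟩⟩ := K.isoClosure.le_shift (-1 : ℤ) _ (K.le_isoClosure k hk)
  let e' := (shiftFunctorCompIsoId T (-1 : ℤ) 1 (by simp)).app k
  obtain ⟨g, hg⟩ := (shiftFunctor T (1 : ℤ)).map_surjective (e'.hom ≫ f ≫ c)
  have hga : g ≫ a = 0 := (shiftFunctor T (1 : ℤ)).map_injective (by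
    rw [Functor.map_comp, hg, Functor.map_zero, Category.assoc, Category.assoc, hac, comp_zero,
      comp_zero])
  have hg0 : g = 0 := by
    rw [← cancel_epi e.inv]
    exact (ha k' hk').1 (by simp [hga])
  have hfc : f ≫ c = 0 := by
    rw [← cancel_epi e'.hom, ← hg, hg0, Functor.map_zero, comp_zero]
  obtain ⟨h, hh⟩ : ∃ h : k ⟶ X, f = h ≫ b := Triangle.coyoneda_exact₃ _ hT f hfc
  obtain ⟨h', rfl⟩ := (ha k hk).2 h
  rw [hh, Category.assoc, hab, comp_zero]

/-- Universal arrows are unique up to isomorphism, so the given triangle is isomorphic to one formed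
by the counit and the unit. -/
lemma exists_distinguished_counit_unit {P Q : ObjectProperty T} [P.IsTriangulated]
    [Q.IsTriangulated] (hP : P L) (hQ : Q Y) (hPY : P.rightOrthogonal Y)
    (hQL : Q.leftOrthogonal L) {R : T ⥤ P.FullSubcategory} {S : T ⥤ Q.FullSubcategory}
    (adj : P.ι ⊣ R) (adj' : S ⊣ Q.ι) :
    ∃ d : Q.ι.obj (S.obj X) ⟶ (P.ι.obj (R.obj X))⟦(1 : ℤ)⟧,
      Triangle.mk (adj.counit.app X) (adj'.unit.app X) d ∈ distTriang T := by
  obtain ⟨e, he⟩ := exists_iso_counit (F := P.ι) (X := ⟨L, hP⟩) adj a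
    (bijective_ι_map_comp hT P hP hPY)
  obtain ⟨e', he'⟩ := exists_iso_unit (G := Q.ι) (Y := ⟨Y, hQ⟩) adj' b
    (bijective_comp_ι_map hT Q hQ hQL)
  refine ⟨(Q.ι.mapIso e').inv ≫ c ≫ ((P.ι.mapIso e).inv)⟦(1 : ℤ)⟧',
    isomorphic_distinguished _ hT _ (Triangle.isoMk _ _ (P.ι.mapIso e) (Iso.refl X)
      (Q.ι.mapIso e').symm ?_ ?_ ?_)⟩
  · exact (Category.comp_id _).trans he.symm
  · change adj'.unit.app X ≫ Q.ι.map e'.inv = 𝟙 X ≫ b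
    rw [← he', Category.assoc, ← Q.ι.map_comp, e'.hom_inv_id, Q.ι.map_id, Category.id_comp]
    exact Category.comp_id _
  · change (Q.ι.map e'.inv ≫ c ≫ (P.ι.map e.inv)⟦(1 : ℤ)⟧') ≫ (P.ι.map e.hom)⟦(1 : ℤ)⟧' =
      Q.ι.map e'.inv ≫ c
    rw [Category.assoc, Category.assoc, ← Functor.map_comp, ← P.ι.map_comp, e.inv_hom_id,
      P.ι.map_id]
    exact Q.ι.map e'.inv ≫= ((c ≫= (shiftFunctor T (1 : ℤ)).map_id L).trans (Category.comp_id c))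

end

/-- The left orthogonal of `K^⊥` is itself localizing and contains `K`. -/
lemma localizingClosure_le_leftOrthogonal (K : ObjectProperty T)
    [K.isoClosure.IsStableUnderShift ℤ] :
    localizingClosure K ≤ K.rightOrthogonal.leftOrthogonal := by
  refine fun X hX ↦ hX _ ⟨inferInstance, inferInstance, fun ι ↦ ⟨fun X ⟨h⟩ Y f hY ↦ ?_⟩⟩
    fun k hk Y f hY ↦ hY f hk
  exact h.isColimit.hom_ext fun j ↦
    (h.prop_diag_obj j _ hY).trans comp_zero.symm

lemma rightOrthogonal_le_rightOrthogonal_localizingClosure (K : ObjectProperty T)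
    [K.isoClosure.IsStableUnderShift ℤ] :
    K.rightOrthogonal ≤ (localizingClosure K).rightOrthogonal :=
  fun _ hY _ f hX ↦ localizingClosure_le_leftOrthogonal K _ hX f hY

lemma isZero_of_localizingClosure_of_rightOrthogonal {K : ObjectProperty T}
    [K.isoClosure.IsStableUnderShift ℤ] {X : T} (hX : localizingClosure K X)
    (hX' : K.rightOrthogonal X) : IsZero X :=
  (IsZero.iff_id_eq_zero X).2 (localizingClosure_le_leftOrthogonal K _ hX _ hX')

/-- A morphism in the localizing subcategory generated by `K` is an isomorphism if it is detected
to be so by morphisms from the objects in `K`. -/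
lemma isIso_of_bijective (K : ObjectProperty T) [K.isoClosure.IsStableUnderShift ℤ] {L X : T}
    (hL : localizingClosure K L) (hX : localizingClosure K X) (a : L ⟶ X)
    (ha : ∀ k, K k → Function.Bijective fun f : k ⟶ L ↦ f ≫ a) : IsIso a := by
  obtain ⟨Y, b, c, hT⟩ := distinguished_cocone_triangle a
  refine (Triangle.isZero₃_iff_isIso₁ _ hT).1 (isZero_of_localizingClosure_of_rightOrthogonal
    (ObjectProperty.ext_of_isTriangulatedClosed₃ _ _ hT hL hX) ?_)
  exact rightOrthogonal_of_bijective hT K ha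

variable [HasCoproducts.{v} T] (K : ObjectProperty T) [ObjectProperty.Small.{v} K]
    [K.isoClosure.IsStableUnderShift ℤ]

/-- The localization triangle of an object with respect to a small set of finitary objects. -/
theorem exists_localization_triangle (hK : ∀ k, K k → IsFinitary k) (X : T) :
    ∃ (L Y : T) (a : L ⟶ X) (b : X ⟶ Y) (c : Y ⟶ L⟦(1 : ℤ)⟧),
      Triangle.mk a b c ∈ distTriang T ∧ localizingClosure K L ∧ K.rightOrthogonal Y := by
  obtain ⟨L, a, hL, ha⟩ := exists_approximation (𝟭 T) X K hK
  obtain ⟨Y, b, c, hT⟩ := distinguished_cocone_triangle (a : L ⟶ X)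
  exact ⟨L, Y, a, b, c, hT, hL, rightOrthogonal_of_bijective hT K ha⟩

lemma isLeftAdjoint_localizingClosure_ι (hK : ∀ k, K k → IsFinitary k) :
    (localizingClosure K).ι.IsLeftAdjoint :=
  isLeftAdjoint_of_bijective _ fun X ↦ by
    obtain ⟨L, Y, a, b, c, hT, hL, hY⟩ := exists_localization_triangle K hK X
    exact ⟨⟨L, hL⟩, a, bijective_ι_map_comp hT _ hL
      (rightOrthogonal_le_rightOrthogonal_localizingClosure K _ hY)⟩

lemma isRightAdjoint_rightOrthogonal_ι (hK : ∀ k, K k → IsFinitary k) :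
    K.rightOrthogonal.ι.IsRightAdjoint :=
  isRightAdjoint_of_bijective _ fun X ↦ by
    obtain ⟨L, Y, a, b, c, hT, hL, hY⟩ := exists_localization_triangle K hK X
    exact ⟨⟨Y, hY⟩, b, bijective_comp_ι_map hT _ hY (localizingClosure_le_leftOrthogonal K _ hL)⟩

end Orthogonal

/-! ### The coreflection onto ⟨K⟩ preserves coproducts -/

section Coreflection

variable {T : Type u} [Category.{v} T] [Preadditive T]

/-- Injectivity is checked on components, surjectivity on maps through one summand. -/
lemma IsFinitary.bijective_comp_sigmaMap [HasCoproducts.{v} T] {k : T} (hk : IsFinitary k)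
    {ι : Type v} {L Y : ι → T} (ε : ∀ i, L i ⟶ Y i)
    (h : ∀ i, Function.Bijective fun f : k ⟶ L i ↦ f ≫ ε i) :
    Function.Bijective fun f : k ⟶ ∐ L ↦ f ≫ Limits.Sigma.map ε := by
  refine ⟨fun f g hfg ↦ ?_, fun g ↦ ?_⟩
  · obtain ⟨p, hp, hp'⟩ := exists_projections _ (coproductIsCoproduct L)
    obtain ⟨q, hq, hq'⟩ := exists_projections _ (coproductIsCoproduct Y)
    have hpq (i : ι) : Limits.Sigma.map ε ≫ q i = p i ≫ ε i := Sigma.hom_ext _ _ fun j ↦ by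
      simp only [cofan_mk_inj] at hp hp' hq hq'
      rw [Sigma.ι_map_assoc]
      obtain rfl | hij := eq_or_ne j i
      · exact (ε j ≫= hq j).trans ((Category.comp_id _).trans
          ((Category.id_comp _).symm.trans (((hp j).symm =≫ ε j).trans (Category.assoc ..))))
      · exact (ε j ≫= hq' j i hij).trans (comp_zero.trans
          (zero_comp.symm.trans (((hp' j i hij).symm =≫ ε i).trans (Category.assoc ..))))
    rw [← sub_eq_zero]
    refine hk.eq_zero_of_comp_projections _ (coproductIsCoproduct L) hp hp' fun i ↦ ?_
    have := hfg =≫ q i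
    simp only [Category.assoc, hpq] at this
    have : f ≫ p i = g ≫ p i := (h i).1 ((Category.assoc ..).trans
      (this.trans (Category.assoc ..).symm))
    exact (Preadditive.sub_comp ..).trans (sub_eq_zero.2 this)
  · dsimp
    induction hk _ (coproductIsCoproduct Y) g using AddSubgroup.closure_induction with
    | mem g hg =>
      obtain ⟨i, g', rfl⟩ := hg
      obtain ⟨f, rfl⟩ := (h i).2 g'
      exact ⟨f ≫ Sigma.ι L i, by simp⟩
    | zero => exact ⟨0, zero_comp⟩
    | add g g' _ _ hg hg' =>
      obtain ⟨f, rfl⟩ := hg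
      obtain ⟨f', rfl⟩ := hg'
      exact ⟨f + f', Preadditive.add_comp ..⟩
    | neg g _ hg =>
      obtain ⟨f, rfl⟩ := hg
      exact ⟨-f, Preadditive.neg_comp ..⟩

omit [Preadditive T] in
lemma bijective_comp_counit {P : ObjectProperty T} {R : T ⥤ P.FullSubcategory} (adj : P.ι ⊣ R)
    {k : T} (hk : P k) (X : T) :
    Function.Bijective fun f : k ⟶ P.ι.obj (R.obj X) ↦ f ≫ adj.counit.app X := by
  have h := (adj.homEquiv ⟨k, hk⟩ X).symm.bijective.comp
    (P.fullyFaithfulι.homEquiv (X := ⟨k, hk⟩) (Y := R.obj X)).symm.bijective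
  convert! h using 2 with f

variable [HasZeroObject T] [HasShift T ℤ]
  [∀ n : ℤ, (shiftFunctor T n).Additive] [Pretriangulated T]
  [HasCoproducts.{v} T] {K : ObjectProperty T} [K.isoClosure.IsStableUnderShift ℤ]
  {R : T ⥤ (localizingClosure K).FullSubcategory}

/-- The comparison map lies in ⟨K⟩, so objects of `K` detect whether it is an isomorphism. Followed
by the counit, it becomes the coproduct of the counits. -/
lemma preservesCoproducts_of_adjunction (hK : ∀ k, K k → IsFinitary k)
    (adj : (localizingClosure K).ι ⊣ R) (ι : Type v) :
    PreservesColimitsOfShape (Discrete ι) R := by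
  let G : T ⥤ T := R ⋙ (localizingClosure K).ι
  suffices PreservesColimitsOfShape (Discrete ι) G from
    preservesColimitsOfShape_of_reflects_of_preserves R (localizingClosure K).ι
  suffices ∀ Y : ι → T, PreservesColimit (Discrete.functor Y) G from
    preservesColimitsOfShape_of_discrete G
  intro Y
  suffices IsIso (sigmaComparison G Y) from PreservesCoproduct.of_iso_comparison G Y
  refine isIso_of_bijective K (ObjectProperty.prop_colimit _ _ fun i ↦ (R.obj (Y i.as)).property)
    (R.obj (∐ Y)).property _ fun k hk ↦ ?_
  have h (X : T) := bijective_comp_counit adj (le_localizingClosure K _ hk) X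
  refine (Function.Bijective.of_comp_iff' (h (∐ Y)) _).1 ?_
  have hε : sigmaComparison G Y ≫ adj.counit.app (∐ Y) =
      Limits.Sigma.map fun i ↦ adj.counit.app (Y i) := Sigma.hom_ext _ _ fun i ↦ by
    rw [ι_comp_sigmaComparison_assoc, Sigma.ι_map]
    exact adj.counit.naturality (Sigma.ι Y i)
  convert! (hK k hk).bijective_comp_sigmaMap (fun i ↦ adj.counit.app (Y i))
    (fun i ↦ h (Y i)) using 2 with f
  rw [← hε]
  exact Category.assoc ..

end Coreflection

/-! ### Compact generation and Brown representability -/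

section Generators

variable {T : Type u} [Category.{v} T] [Preadditive T] [HasZeroObject T] [HasShift T ℤ]
  [∀ n : ℤ, (shiftFunctor T n).Additive] [Pretriangulated T]

/-- The objects of `S` and all their shifts. -/
def shifts (S : ObjectProperty T) : ObjectProperty T := fun X ↦ ∃ Z, S Z ∧ ∃ n : ℤ, X = Z⟦n⟧

instance (S : ObjectProperty T) [ObjectProperty.Small.{v} S] :
    ObjectProperty.Small.{v} (shifts S) :=
  small_of_surjective (α := Subtype S × ℤ)
    (f := fun x ↦ ⟨x.1.1⟦x.2⟧, x.1.1, x.1.2, x.2, rfl⟩)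
    (by rintro ⟨_, Z, hZ, n, rfl⟩; exact ⟨⟨⟨Z, hZ⟩, n⟩, rfl⟩)

instance (S : ObjectProperty T) : (shifts S).isoClosure.IsStableUnderShift ℤ where
  isStableUnderShiftBy a := ⟨by
    rintro X ⟨_, ⟨Z, hZ, n, rfl⟩, ⟨e⟩⟩
    exact ⟨Z⟦n + a⟧, ⟨Z, hZ, _, rfl⟩,
      ⟨(shiftFunctor T a).mapIso e ≪≫ ((shiftFunctorAdd T n a).app Z).symm⟩⟩⟩

/-- A compactly generated triangulated category is the localizing subcategory generated by a small
shift-stable set of finitary objects. -/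
lemma IsCompactlyGenerated.exists_localizingClosure_eq_top [IsCompactlyGenerated T] :
    ∃ S : ObjectProperty T, ObjectProperty.Small.{v} S ∧ S.isoClosure.IsStableUnderShift ℤ ∧
      (∀ X, S X → IsFinitary X) ∧ ∀ X, localizingClosure S X := by
  have : HasCoproducts.{v} T := IsCompactlyGenerated.hasCoproducts
  obtain ⟨S, _, hS, hS'⟩ := IsCompactlyGenerated.exists_generators (T := T)
  have hfin : ∀ X, shifts S X → IsFinitary X := by
    rintro _ ⟨Z, hZ, n, rfl⟩
    exact (hS Z hZ).isFinitary.shift n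
  refine ⟨shifts S, inferInstance, inferInstance, hfin, fun X ↦ ?_⟩
  obtain ⟨L, Y, a, b, c, hT, hL, hY⟩ := exists_localization_triangle (shifts S) hfin X
  -- `Y` is orthogonal to all shifts of the generators, hence zero.
  have : IsIso a := (Triangle.isZero₃_iff_isIso₁ _ hT).1
    (hS' Y fun Z hZ n f ↦ hY f ⟨Z, hZ, n, rfl⟩)
  exact (localizingClosure (shifts S)).prop_of_iso (asIso a) hL

/-- Brown representability: triangulated functors preserving coproducts from a compactly generated
triangulated category have a right adjoint. -/
theorem isLeftAdjoint_of_preservesCoproducts [IsCompactlyGenerated T] {D : Type*} [Category.{v} D]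
    [Preadditive D] [HasZeroObject D] [HasShift D ℤ] [∀ n : ℤ, (shiftFunctor D n).Additive]
    [Pretriangulated D] (F : T ⥤ D) [F.CommShift ℤ] [F.IsTriangulated]
    [∀ ι : Type v, PreservesColimitsOfShape (Discrete ι) F] : F.IsLeftAdjoint := by
  have : HasCoproducts.{v} T := IsCompactlyGenerated.hasCoproducts
  obtain ⟨S, _, _, hS, hS'⟩ := IsCompactlyGenerated.exists_localizingClosure_eq_top (T := T)
  refine isLeftAdjoint_of_bijective F fun C ↦ ?_
  obtain ⟨X, φ, -, hφ⟩ := exists_approximation F C S hS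
  refine ⟨X, φ, fun Z ↦ ?_⟩
  refine mapComp_bijective_of_iso φ ((shiftFunctorZero T ℤ).app Z)
    (hS' Z _ (isLocalizing_mapComp_bijective φ) (fun k hk n ↦ ?_) 0)
  obtain ⟨k', hk', ⟨e⟩⟩ := S.isoClosure.le_shift n _ (S.le_isoClosure k hk)
  exact mapComp_bijective_of_iso φ e.symm (hφ k' hk')

end Generators

end WrongWay

/-! ### Assembling the recollement -/

theorem mainTheorem2 {T : Type u} [Category.{v} T] [Preadditive T] [HasZeroObject T]
    [HasShift T ℤ] [∀ n : ℤ, (shiftFunctor T n).Additive] [Pretriangulated T] [IsTriangulated T]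
    [WrongWay.IsCompactlyGenerated T]
    (K : ObjectProperty T) [ObjectProperty.Small.{v} K] [K.isoClosure.IsStableUnderShift ℤ]
    (hK : ∀ X, K X → WrongWay.IsCompactObject X) :
    ∃ (iUpper iShriek : T ⥤ K.rightOrthogonal.FullSubcategory)
      (jUpper : T ⥤ (WrongWay.localizingClosure K).FullSubcategory)
      (jLower : (WrongWay.localizingClosure K).FullSubcategory ⥤ T)
      (_ : iUpper.CommShift ℤ) (_ : iShriek.CommShift ℤ)
      (_ : jUpper.CommShift ℤ) (_ : jLower.CommShift ℤ)
      (adj₁ : iUpper ⊣ K.rightOrthogonal.ι) (adj₂ : K.rightOrthogonal.ι ⊣ iShriek)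
      (adj₃ : (WrongWay.localizingClosure K).ι ⊣ jUpper) (adj₄ : jUpper ⊣ jLower),
      WrongWay.IsRecollement adj₁ adj₂ adj₃ adj₄ := by
  open WrongWay in
  have : HasCoproducts.{v} T := IsCompactlyGenerated.hasCoproducts
  have hK' : ∀ X, K X → IsFinitary X := fun X hX ↦ (hK X hX).isFinitary
  have := isLeftAdjoint_localizingClosure_ι K hK'
  have := isRightAdjoint_rightOrthogonal_ι K hK'
  let P := localizingClosure K
  let Q := K.rightOrthogonal
  let jUpper := Functor.rightAdjoint P.ι
  let adj₃ : P.ι ⊣ jUpper := Adjunction.ofIsLeftAdjoint P.ι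
  let iUpper := Functor.leftAdjoint Q.ι
  let adj₁ : iUpper ⊣ Q.ι := Adjunction.ofIsRightAdjoint Q.ι
  let : jUpper.CommShift ℤ := adj₃.rightAdjointCommShift ℤ
  have : adj₃.CommShift ℤ := adj₃.commShift_of_leftAdjoint ℤ
  have hadj₃ : adj₃.IsTriangulated := .mk' adj₃
  let : iUpper.CommShift ℤ := adj₁.leftAdjointCommShift ℤ
  have : adj₁.CommShift ℤ := adj₁.commShift_of_rightAdjoint ℤ
  have hadj₁ : adj₁.IsTriangulated := .mk'' adj₁
  have : ∀ ι : Type v, PreservesColimitsOfShape (Discrete ι) jUpper :=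
    preservesCoproducts_of_adjunction hK' adj₃
  have : jUpper.IsLeftAdjoint := isLeftAdjoint_of_preservesCoproducts jUpper
  let jLower := Functor.rightAdjoint jUpper
  let adj₄ : jUpper ⊣ jLower := Adjunction.ofIsLeftAdjoint jUpper
  let : jLower.CommShift ℤ := adj₄.rightAdjointCommShift ℤ
  have : adj₄.CommShift ℤ := adj₄.commShift_of_leftAdjoint ℤ
  have hadj₄ : adj₄.IsTriangulated := .mk' adj₄
  -- In an adjoint triple, the outer left functor is fully faithful if and only if the outer right
  -- one is.
  let hj : jLower.FullyFaithful :=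
    (Adjunction.Triple.mk adj₃ adj₄).fullyFaithfulEquiv P.fullyFaithfulι
  have hj₁ := hj.full
  have hj₂ := hj.faithful
  have hzero : ∀ M : Q.FullSubcategory, IsZero (jUpper.obj (Q.ι.obj M)) := fun M ↦ by
    refine (IsZero.iff_id_eq_zero _).2 ((adj₃.homEquiv _ _).symm.injective ?_)
    have h := localizingClosure_le_leftOrthogonal K _ (jUpper.obj (Q.ι.obj M)).property
    exact (h _ M.property).trans (h _ M.property).symm
  have hQj : ∀ C, Q.rightOrthogonal (jLower.obj C) := fun C M f hM ↦
    (adj₄.homEquiv _ _).symm.injective ((hzero ⟨M, hM⟩).eq_of_src _ _)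
  have htri : ∀ X : T, ∃ (W : T) (a : W ⟶ X)
      (c : jLower.obj (jUpper.obj X) ⟶ W⟦(1 : ℤ)⟧),
      Triangle.mk a (adj₄.unit.app X) c ∈ distTriang T ∧ Q W := fun X ↦ by
    obtain ⟨W, a, c, hT⟩ := distinguished_cocone_triangle₁ (adj₄.unit.app X)
    refine ⟨W, a, c, hT, fun k f hk ↦ ?_⟩
    -- The counit of `adj₄` is invertible because `jLower` is fully faithful; the triangle identity
    -- then inverts `j^*` of the unit, so `j^* W = 0`.
    have : IsIso (jUpper.map (adj₄.unit.app X)) :=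
      isIso_of_comp_hom_eq_id _ (adj₄.left_triangle_components X)
    have hW : IsZero (jUpper.obj W) :=
      Triangle.isZero₁_of_isIso₂ _ (jUpper.map_distinguished _ hT) this
    exact (adj₃.homEquiv ⟨k, le_localizingClosure K k hk⟩ W).injective (hW.eq_of_tgt _ _)
  -- `K^⊥` is left orthogonal to the image of `j_*`, so `W ⟶ X` is a universal arrow from `K^⊥`.
  have : Q.ι.IsLeftAdjoint := isLeftAdjoint_of_bijective _ fun X ↦ by
    obtain ⟨W, a, c, hT, hW⟩ := htri X
    exact ⟨⟨W, hW⟩, a, bijective_ι_map_comp hT _ hW (hQj _)⟩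
  let iShriek := Functor.rightAdjoint Q.ι
  let adj₂ : Q.ι ⊣ iShriek := Adjunction.ofIsLeftAdjoint Q.ι
  let : iShriek.CommShift ℤ := adj₂.rightAdjointCommShift ℤ
  have : adj₂.CommShift ℤ := adj₂.commShift_of_leftAdjoint ℤ
  have hadj₂ : adj₂.IsTriangulated := .mk' adj₂
  refine ⟨iUpper, iShriek, jUpper, jLower, inferInstance, inferInstance, inferInstance,
    inferInstance, adj₁, adj₂, adj₃, adj₄, hadj₁, hadj₂, hadj₃, hadj₄, hzero, inferInstance,
    inferInstance, inferInstance, inferInstance, hj₁, hj₂, fun X ↦ ?_, fun X ↦ ?_⟩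
  · obtain ⟨L, Y, a, b, c, hT, hL, hY⟩ := exists_localization_triangle K hK' X
    exact exists_distinguished_counit_unit hT hL hY
      (rightOrthogonal_le_rightOrthogonal_localizingClosure K _ hY)
      (localizingClosure_le_leftOrthogonal K _ hL) adj₃ adj₁
  · obtain ⟨W, a, c, hT, hW⟩ := htri X
    obtain ⟨e, he⟩ := exists_iso_counit (F := Q.ι) (X := ⟨W, hW⟩) adj₂ a
      (bijective_ι_map_comp hT Q hW (hQj _))
    refine ⟨c ≫ ((Q.ι.mapIso e).inv)⟦(1 : ℤ)⟧', isomorphic_distinguished _ hT _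
      (Triangle.isoMk _ _ (Q.ι.mapIso e) (Iso.refl X) (Iso.refl _) ?_ ?_ ?_)⟩
    · exact (Category.comp_id _).trans he.symm
    · exact (Category.comp_id _).trans (Category.id_comp _).symm
    · change (c ≫ (Q.ι.map e.inv)⟦(1 : ℤ)⟧') ≫ (Q.ι.map e.hom)⟦(1 : ℤ)⟧' = 𝟙 _ ≫ c
      rw [Category.assoc, ← Functor.map_comp, ← Q.ι.map_comp, e.inv_hom_id, Q.ι.map_id,
        Category.id_comp]
      exact (c ≫= (shiftFunctor T (1 : ℤ)).map_id W).trans (Category.comp_id c)
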